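/- Let $\bar G=(V,\bar E)$ be a finite connected undirected simple graph with adjacency matrix $\bar A=(\bar a_{ik})$, let $\lambda_{max}$ and $\lambda_{min}$ be the greatest and smallest eigenvalues of $\bar A$, and let $\Gamma=\operatorname{Aut}(\bar G)$. Let $d>0$, $\alpha>0$, $\gamma\in\mathbb R$, and let $S:\mathbb R\to\mathbb R$ be a twice differentiable, odd, bounded function with $S(0)=0$, $S'(0)=1$ and $\operatorname{sign}S''(z)=-\operatorname{sign}(z)$ for all $z$. Consider the opinion dynamics with common attention $u\ge 0$ and zero inputs, $$\dot x_i=-d\,x_i+u\,S\Big(\alpha x_i+\gamma\sum_{k\ne i}\bar a_{ik}x_k\Big),\qquad i\in V .$$ Write $i\sim k$ if $k=\rho i$ for some $\rho\in\Gamma$, and put $u_a=d/(\alpha+\gamma\lambda_{max})$, $u_d=d/(\alpha+\gamma\lambda_{min})$. (A) Suppose $\gamma>0$. There is a neighbourhood of $(\mathbf x,u)=(\mathbf 0,u_a)$ such that for every $(\mathbf x,u)$ in it with $\mathbf x$ an equilibrium at attention $u$ (in particular, for the agreement equilibria that bifurcate from the neutral state $\mathbf x=\mathbf 0$ at $u=u_a$),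 $i\sim k$ implies $x_i=x_k$. Moreover, for every $u\ge 0$ and every agreement equilibrium $\mathbf x$ at attention $u$ (all $x_i$ nonzero and of the same sign), $i\sim k$ implies $x_i=x_k$. (B) Suppose $\gamma<0$ and $\lambda_{min}$ has multiplicity $1$. There is a neighbourhood of $(\mathbf x,u)=(\mathbf 0,u_d)$ such that for every $(\mathbf x,u)$ in it with $\mathbf x$ an equilibrium at attention $u$ (in particular, for the disagreement equilibria, i.e. those with two opinions of opposite sign, that bifurcate from the neutral state at $u=u_d$), $i\sim k$ implies $|x_i|=|x_k|$. -/

import Mathlib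

open Filter Topology

namespace OpinionDynamics

/-- The standing assumptions on the nonlinearity `S`: it is twice differentiable, odd, saturating
(bounded), `S 0 = 0`, `S' 0 = 1`, and `sign (S'' z) = - sign z` for every `z`. -/
structure IsSaturation (S : ℝ → ℝ) : Prop where
  differentiable : Differentiable ℝ S
  differentiable_deriv : Differentiable ℝ (deriv S)
  odd : ∀ z, S (-z) = -S z
  bounded : ∃ B, ∀ z, |S z| ≤ B
  map_zero : S 0 = 0
  deriv_zero : deriv S 0 = 1
  sign_deriv_deriv : ∀ z, SignType.sign (deriv (deriv S) z) = -SignType.sign z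

section

variable {V : Type*} [Fintype V] [DecidableEq V]

/-- The vector field `h` of the homogeneous opinion dynamics `ẋ = h x`, with resistance `d`,
self-weight `α`, edge weight `γ`, attentions `u i` and inputs `b i`:
`h_i x = - d x_i + u_i S (α x_i + γ ∑_{k ≠ i} a_{ik} x_k) + b_i`. -/
def vectorField (G : SimpleGraph V) [DecidableRel G.Adj] (S : ℝ → ℝ) (d α γ : ℝ)
    (u b : V → ℝ) (x : V → ℝ) (i : V) : ℝ :=
  -d * x i + u i * S (α * x i + γ * ∑ k ∈ Finset.univ.erase i, G.adjMatrix ℝ i k * x k) + b i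

/-- `x` is an equilibrium of the opinion dynamics with common attention `u` and zero inputs. -/
def IsEquilibrium (G : SimpleGraph V) [DecidableRel G.Adj] (S : ℝ → ℝ) (d α γ u : ℝ)
    (x : V → ℝ) : Prop :=
  ∀ i, vectorField G S d α γ (fun _ => u) (fun _ => 0) x i = 0

/-- The greatest eigenvalue of the adjacency matrix. (The adjacency matrix is real symmetric, so
for nonempty `V` its real spectrum is finite, nonempty, and contains all its eigenvalues.) -/
noncomputable def lambdaMax (G : SimpleGraph V) [DecidableRel G.Adj] : ℝ :=
  sSup (spectrum ℝ (G.adjMatrix ℝ))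

/-- The smallest eigenvalue of the adjacency matrix. -/
noncomputable def lambdaMin (G : SimpleGraph V) [DecidableRel G.Adj] : ℝ :=
  sInf (spectrum ℝ (G.adjMatrix ℝ))

/-- The generalized eigenspace `W(μ)` of the adjacency matrix. -/
def genEigenspace (G : SimpleGraph V) [DecidableRel G.Adj] (μ : ℝ) : Submodule ℝ (V → ℝ) :=
  Module.End.maxGenEigenspace (Matrix.toLin' (G.adjMatrix ℝ)) μ

/-- The critical attention `u_a = d / (α + γ λ_max)` of the agreement bifurcation. -/
noncomputable def agreementThreshold (G : SimpleGraph V) [DecidableRel G.Adj] (d α γ : ℝ) : ℝ :=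
  d / (α + γ * lambdaMax G)

/-- The critical attention `u_d = d / (α + γ λ_min)` of the disagreement bifurcation. -/
noncomputable def disagreementThreshold (G : SimpleGraph V) [DecidableRel G.Adj] (d α γ : ℝ) : ℝ :=
  d / (α + γ * lambdaMin G)

end

/-- Agreement state: all opinions are nonzero and have the same sign. -/
def IsAgreement {V : Type*} (x : V → ℝ) : Prop :=
  (∀ i, x i ≠ 0) ∧ ∀ i k, SignType.sign (x i) = SignType.sign (x k)

/-- `i ∼ k`: some automorphism of the graph maps `i` to `k`. -/
def SameOrbit {V : Type*} (G : SimpleGraph V) (i k : V) : Prop :=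
  ∃ ρ : G ≃g G, k = ρ i

end OpinionDynamics

namespace OpinionDynamics

/-! ### The nonlinearity -/

namespace IsSaturation

variable {S : ℝ → ℝ}

/-! Equilibria are permuted by automorphisms and, as `S` is odd, by negation; symmetry of an
equilibrium thus follows from uniqueness. Near a threshold, the linearization at the neutral state
has the critical eigenspace as kernel, so adding one functional `l` injective on that kernel makes
equilibria locally determined by `l x` and `u` (`eventually_eq_of_functional_eq`). For agreement,
`l` is the coordinate sum, by a Perron–Frobenius argument; for disagreement, the pairing with the
simple eigenvector, which each automorphism fixes up to a sign `ε`. Then `x` and `ε • (x ∘ ρ)` share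
`l` and `u`, hence agree. Away from the threshold, sublinearity of `S` allows at most one positive
equilibrium (`eq_of_isEquilibrium_of_pos`). -/

theorem hasStrictDerivAt_zero (hS : IsSaturation S) : HasStrictDerivAt S 1 0 := by
  have h := hasStrictDerivAt_of_hasDerivAt_of_continuousAt (f := S) (f' := deriv S) (x := 0)
    (Eventually.of_forall fun y => (hS.differentiable y).hasDerivAt)
    hS.differentiable_deriv.continuous.continuousAt
  rwa [hS.deriv_zero] at h

theorem strictConcaveOn (hS : IsSaturation S) : StrictConcaveOn ℝ (Set.Ici 0) S := by
  refine strictConcaveOn_of_deriv2_neg (convex_Ici 0) hS.differentiable.continuous.continuousOn ?_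
  intro z hz
  rw [interior_Ici] at hz
  have h := hS.sign_deriv_deriv z
  rw [sign_pos (show 0 < z from hz)] at h
  exact sign_eq_neg_one_iff.1 h

/-- A saturation grows sublinearly: `S (t z) < t S z` for `t > 1` and `z > 0`. -/
theorem map_mul_lt (hS : IsSaturation S) {t z : ℝ} (ht : 1 < t) (hz : 0 < z) :
    S (t * z) < t * S z := by
  have ht0 : 0 < t := by linarith
  have h := hS.strictConcaveOn.2 (Set.mem_Ici.2 le_rfl)
    (Set.mem_Ici.2 (by positivity : 0 ≤ t * z)) (by positivity)
    (sub_pos.2 (inv_lt_one_of_one_lt₀ ht)) (by positivity : 0 < t⁻¹) (by ring)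
  simp only [smul_eq_mul, mul_zero, zero_add, hS.map_zero] at h
  rw [inv_mul_cancel_left₀ ht0.ne', inv_mul_lt_iff₀ ht0] at h
  exact h

/-- Once a concave function descends, it keeps descending at least as steeply, which contradicts
boundedness. -/
theorem monotoneOn (hS : IsSaturation S) : MonotoneOn S (Set.Ici 0) := by
  intro a ha b hb hab
  by_contra! hlt
  obtain ⟨B, hB⟩ := hS.bounded
  have hne : a < b := lt_of_le_of_ne hab (by rintro rfl; exact lt_irrefl _ hlt)
  set s := (S a - S b) / (b - a) with hs
  have hs0 : 0 < s := div_pos (by linarith) (by linarith)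
  obtain ⟨c, hc, hBc⟩ : ∃ c, b < c ∧ 2 * B < s * (c - b) := by
    refine ⟨b + (2 * |B| + 1) / s, lt_add_of_pos_right _ (by positivity), ?_⟩
    rw [add_sub_cancel_left, mul_div_cancel₀ _ hs0.ne']
    linarith [le_abs_self B]
  have h := hS.strictConcaveOn.slope_anti_adjacent ha (hb.trans hc.le : c ∈ Set.Ici (0 : ℝ)) hne hc
  rw [div_lt_iff₀ (by linarith)] at h
  have hs' : (S b - S a) / (b - a) = -s := by rw [hs, ← neg_div, neg_sub]
  rw [hs'] at h
  have h1 := abs_le.1 (hB b)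
  have h2 := abs_le.1 (hB c)
  linarith

end IsSaturation

/-! ### Local uniqueness of equilibria modulo the critical direction -/

section LocalUniqueness

variable {V : Type*} [Fintype V]

/-- Augmenting the equilibrium map by `l` and the parameter `u` gives an injective strict
derivative, hence local injectivity; no implicit function is needed. -/
theorem eventually_eq_of_functional_eq {S : ℝ → ℝ} (hS : HasStrictDerivAt S 1 0) (hS0 : S 0 = 0)
    (M : (V → ℝ) →L[ℝ] (V → ℝ)) (l : (V → ℝ) →L[ℝ] ℝ) (d u₀ : ℝ)
    (hker : ∀ w : V → ℝ, d • w = u₀ • M w → l w = 0 → w = 0) :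
    ∀ᶠ q : ((V → ℝ) × ℝ) × ((V → ℝ) × ℝ) in 𝓝 ((0, u₀), (0, u₀)),
      (∀ i, d * q.1.1 i = q.1.2 * S (M q.1.1 i)) → (∀ i, d * q.2.1 i = q.2.2 * S (M q.2.1 i)) →
        l q.1.1 = l q.2.1 → q.1.2 = q.2.2 → q.1 = q.2 := by
  let F : (V → ℝ) × ℝ → (V → ℝ) × ℝ × ℝ := fun p => (fun i => d * p.1 i - p.2 * S (M p.1 i), l p.1, p.2)
  let fst : (V → ℝ) × ℝ →L[ℝ] (V → ℝ) := ContinuousLinearMap.fst ℝ _ _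
  let snd : (V → ℝ) × ℝ →L[ℝ] ℝ := ContinuousLinearMap.snd ℝ _ _
  let F' : (V → ℝ) × ℝ →L[ℝ] (V → ℝ) × ℝ × ℝ :=
    (d • fst - u₀ • M.comp fst).prod ((l.comp fst).prod snd)
  have hF : HasStrictFDerivAt F F' (0, u₀) := by
    refine HasStrictFDerivAt.prodMk ?_
      ((l.comp fst).hasStrictFDerivAt.prodMk snd.hasStrictFDerivAt)
    rw [hasStrictFDerivAt_pi']
    intro i
    let c : (V → ℝ) × ℝ →L[ℝ] ℝ := (ContinuousLinearMap.proj i).comp fst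
    let m : (V → ℝ) × ℝ →L[ℝ] ℝ := (ContinuousLinearMap.proj i).comp (M.comp fst)
    have hm0 : m (0, u₀) = 0 := by simp [m, fst]
    have hSm : HasStrictFDerivAt (fun p => S (m p)) ((1 : ℝ) • m) (0, u₀) :=
      HasStrictDerivAt.comp_hasStrictFDerivAt (f := m) _ (by rwa [hm0]) m.hasStrictFDerivAt
    have h := (c.hasStrictFDerivAt (x := (0, u₀))).const_mul d |>.sub
      ((snd.hasStrictFDerivAt (x := (0, u₀))).mul hSm)
    refine h.congr_fderiv ?_
    ext p <;> simp [c, m, fst, snd, hS0]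
  have hinj : Function.Injective F' := by
    rw [injective_iff_map_eq_zero]
    rintro ⟨w, s⟩ h
    simp only [F', fst, snd, ContinuousLinearMap.prod_apply, Prod.mk_eq_zero] at h
    obtain ⟨h1, h2, h3⟩ := h
    refine Prod.ext (hker w ?_ h2) h3
    exact sub_eq_zero.1 h1
  -- In finite dimension an injective linear map is bounded below, so differences of points are
  -- controlled by differences of values of `F`.
  have hO := (hF.isTheta_sub
    (LinearMap.isClosedEmbedding_of_injective (f := F'.toLinearMap)
      (LinearMap.ker_eq_bot.2 hinj)).isInducing).isBigO_symm
  obtain ⟨C, hC⟩ := hO.bound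
  filter_upwards [hC] with q hq h1 h2 h3 h4
  have hFq : F q.1 = F q.2 := by
    refine Prod.ext (funext fun i => ?_) (Prod.ext h3 h4)
    simp [F, h1 i, h2 i]
  rw [hFq, sub_self, norm_zero, mul_zero, norm_le_zero_iff, sub_eq_zero] at hq
  exact hq

end LocalUniqueness

/-! ### Spectral facts on the adjacency matrix -/

section Spectral

variable {V : Type*} [Fintype V] [DecidableEq V] (G : SimpleGraph V) [DecidableRel G.Adj]

open Matrix

omit [DecidableEq V] in
theorem adjMatrix_mulVec_comp_iso (ρ : G ≃g G) (x : V → ℝ) :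
    G.adjMatrix ℝ *ᵥ (x ∘ ρ) = (G.adjMatrix ℝ *ᵥ x) ∘ ρ := by
  funext i
  simp only [Matrix.mulVec, dotProduct, Function.comp_apply]
  refine Fintype.sum_equiv ρ.toEquiv _ _ fun j => ?_
  simp [SimpleGraph.adjMatrix_apply, SimpleGraph.Iso.map_adj_iff]

theorem posSemidef_lambdaMax_sub :
    (algebraMap ℝ (Matrix V V ℝ) (lambdaMax G) - G.adjMatrix ℝ).PosSemidef := by
  rw [Matrix.posSemidef_iff_isHermitian_and_spectrum_nonneg]
  refine ⟨?_, ?_⟩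
  · rw [Algebra.algebraMap_eq_smul_one]
    exact (Matrix.isHermitian_one.smul (IsSelfAdjoint.all _)).sub (G.isHermitian_adjMatrix ℝ)
  · rw [← spectrum.singleton_sub_eq]
    rintro _ ⟨a, rfl, b, hb, rfl⟩
    exact sub_nonneg.2 (le_csSup (Matrix.finite_real_spectrum (𝕜 := ℝ)).bddAbove hb)

theorem lambdaMin_mem_spectrum [Nonempty V] : lambdaMin G ∈ spectrum ℝ (G.adjMatrix ℝ) := by
  refine Set.Nonempty.csInf_mem ?_ (Matrix.finite_real_spectrum (𝕜 := ℝ))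
  rw [(G.isHermitian_adjMatrix ℝ).spectrum_real_eq_range_eigenvalues]
  exact Set.range_nonempty _

variable {G}

/-- A null vector of the quadratic form of the positive semidefinite `λ_max - A` lies in its kernel.
-/
theorem mulVec_eq_of_quadratic_ge {z : V → ℝ}
    (hz : lambdaMax G * (z ⬝ᵥ z) ≤ z ⬝ᵥ G.adjMatrix ℝ *ᵥ z) :
    G.adjMatrix ℝ *ᵥ z = lambdaMax G • z := by
  have h := posSemidef_lambdaMax_sub G
  have hmul : (algebraMap ℝ (Matrix V V ℝ) (lambdaMax G) - G.adjMatrix ℝ) *ᵥ z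
      = lambdaMax G • z - G.adjMatrix ℝ *ᵥ z := by
    rw [Matrix.sub_mulVec, Algebra.algebraMap_eq_smul_one, Matrix.smul_mulVec, Matrix.one_mulVec]
  have hnn := h.dotProduct_mulVec_nonneg z
  have hiff := h.dotProduct_mulVec_zero_iff z
  rw [hmul] at hiff hnn
  simp only [star_trivial, dotProduct_sub, dotProduct_smul, smul_eq_mul] at hiff hnn
  exact (sub_eq_zero.1 (hiff.1 (by linarith))).symm

/-- The entries of `A` are nonnegative, so passing to `|w|` keeps the norm and does not lower the
quadratic form. -/
theorem abs_mulVec_eq {w : V → ℝ} (hw : G.adjMatrix ℝ *ᵥ w = lambdaMax G • w) :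
    G.adjMatrix ℝ *ᵥ |w| = lambdaMax G • |w| := by
  refine mulVec_eq_of_quadratic_ge ?_
  have h1 : |w| ⬝ᵥ |w| = w ⬝ᵥ w := by simp [dotProduct]
  have h2 : w ⬝ᵥ G.adjMatrix ℝ *ᵥ w = lambdaMax G * (w ⬝ᵥ w) := by
    rw [hw, dotProduct_smul, smul_eq_mul]
  rw [h1, ← h2]
  simp only [dotProduct, Matrix.mulVec, Pi.abs_apply, Finset.mul_sum]
  refine Finset.sum_le_sum fun i _ => Finset.sum_le_sum fun j _ => ?_
  calc w i * (G.adjMatrix ℝ i j * w j) ≤ |w i * (G.adjMatrix ℝ i j * w j)| := le_abs_self _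
    _ = |w i| * (G.adjMatrix ℝ i j * |w j|) := by
      rw [abs_mul, abs_mul]
      congr 2
      rw [SimpleGraph.adjMatrix_apply]
      split_ifs <;> simp

omit [DecidableEq V] in
-- At a zero of `p` the nonnegative values at the neighbours sum to zero, so zeros spread along
-- edges.
theorem eq_zero_of_nonneg_of_apply_eq_zero (hG : G.Connected) {p : V → ℝ} {c : ℝ}
    (hp : G.adjMatrix ℝ *ᵥ p = c • p) (hnn : ∀ i, 0 ≤ p i) {i : V} (hi : p i = 0) : p = 0 := by
  funext j
  have hr := (SimpleGraph.reachable_iff_reflTransGen i j).1 (hG.preconnected i j)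
  induction hr with
  | refl => exact hi
  | @tail b k _ hbk ih =>
    have h := congrFun hp b
    rw [SimpleGraph.adjMatrix_mulVec_apply, Pi.smul_apply, ih, Pi.zero_apply, smul_zero] at h
    exact (Finset.sum_eq_zero_iff_of_nonneg fun j _ => hnn j).1 h k (by simpa using hbk)

/-- An eigenvector of the greatest eigenvalue of a connected graph has constant sign. -/
theorem eq_zero_of_mulVec_eq_of_sum_eq_zero (hG : G.Connected) {w : V → ℝ}
    (hw : G.adjMatrix ℝ *ᵥ w = lambdaMax G • w) (hsum : ∑ i, w i = 0) : w = 0 := by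
  -- Twice the positive part of `w` is an eigenvector, so it vanishes everywhere or nowhere.
  have hp : G.adjMatrix ℝ *ᵥ (|w| + w) = lambdaMax G • (|w| + w) := by
    rw [Matrix.mulVec_add, abs_mulVec_eq hw, hw, smul_add]
  have hnn : ∀ i, 0 ≤ (|w| + w) i := fun i => by
    have := neg_abs_le (w i)
    simp only [Pi.add_apply, Pi.abs_apply]
    linarith
  by_cases h : ∃ i, (|w| + w) i = 0
  · obtain ⟨i, hi⟩ := h
    have h0 := eq_zero_of_nonneg_of_apply_eq_zero hG hp hnn hi
    have hle : ∀ i, w i ≤ 0 := fun i => by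
      have h1 := congrFun h0 i
      simp only [Pi.add_apply, Pi.abs_apply, Pi.zero_apply] at h1
      linarith [abs_nonneg (w i)]
    funext i
    exact (Finset.sum_eq_zero_iff_of_nonpos fun i _ => hle i).1 hsum i (Finset.mem_univ i)
  · push Not at h
    have hpos : ∀ i, 0 < w i := fun i => by
      by_contra! hle
      refine h i ?_
      simp [abs_of_nonpos hle]
    have := hG.nonempty
    exact absurd hsum (Finset.sum_pos (fun i _ => hpos i) Finset.univ_nonempty).ne'

/-- If the smallest eigenvalue is simple, then its eigenspace is a line. -/
theorem exists_eigenvector_lambdaMin [Nonempty V]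
    (h1 : Module.finrank ℝ (genEigenspace G (lambdaMin G)) = 1) :
    ∃ v : V → ℝ, v ≠ 0 ∧ G.adjMatrix ℝ *ᵥ v = lambdaMin G • v ∧
      ∀ w : V → ℝ, G.adjMatrix ℝ *ᵥ w = lambdaMin G • w → ∃ c : ℝ, w = c • v := by
  have hmem := lambdaMin_mem_spectrum G
  rw [← Matrix.spectrum_toLin', ← Module.End.hasEigenvalue_iff_mem_spectrum] at hmem
  obtain ⟨v, hv⟩ := hmem.exists_hasEigenvector
  have hle : ∀ w : V → ℝ, G.adjMatrix ℝ *ᵥ w = lambdaMin G • w →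
      w ∈ genEigenspace G (lambdaMin G) := fun w hw =>
    Module.End.mem_maxGenEigenspace _ _ _ |>.2 ⟨1, by
      simp [hw, Matrix.toLin'_apply]⟩
  have hvA : G.adjMatrix ℝ *ᵥ v = lambdaMin G • v := by
    simpa [Matrix.toLin'_apply] using hv.apply_eq_smul
  refine ⟨v, hv.2, hvA, fun w hw => ?_⟩
  obtain ⟨c, hc⟩ := (finrank_eq_one_iff_of_nonzero'
    (⟨v, hle v hvA⟩ : genEigenspace G (lambdaMin G))
    (fun h => hv.2 (congrArg Subtype.val h))).1 h1 ⟨w, hle w hw⟩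
  exact ⟨c, (congrArg Subtype.val hc).symm⟩

omit [DecidableEq V] in
-- The automorphism acts on the eigenline by a scalar, and it preserves the norm.
theorem comp_iso_eq_or_eq_neg {v : V → ℝ} {μ : ℝ} (hv0 : v ≠ 0)
    (hv : G.adjMatrix ℝ *ᵥ v = μ • v)
    (hspan : ∀ w : V → ℝ, G.adjMatrix ℝ *ᵥ w = μ • w → ∃ c : ℝ, w = c • v) (ρ : G ≃g G) :
    v ∘ ρ = v ∨ v ∘ ρ = -v := by
  obtain ⟨c, hc⟩ := hspan (v ∘ ρ) (by rw [adjMatrix_mulVec_comp_iso, hv]; rfl)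
  have hnorm : (v ∘ ρ) ⬝ᵥ (v ∘ ρ) = v ⬝ᵥ v :=
    Equiv.sum_comp ρ.toEquiv fun i => v i * v i
  have hvv : v ⬝ᵥ v ≠ 0 := fun h => hv0 (dotProduct_self_eq_zero.1 h)
  rw [hc, smul_dotProduct, dotProduct_smul, smul_eq_mul, smul_eq_mul, ← mul_assoc] at hnorm
  rcases mul_self_eq_one_iff.1 (mul_right_cancel₀ hvv (hnorm.trans (one_mul _).symm)) with h | h
  · left; rw [hc, h, one_smul]
  · right; rw [hc, h, neg_smul, one_smul]

end Spectral

/-! ### Equilibria -/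

section Equilibria

variable {V : Type*} [Fintype V] [DecidableEq V] {G : SimpleGraph V} [DecidableRel G.Adj]
  {S : ℝ → ℝ} {d α γ u : ℝ}

open Matrix

variable (G α γ) in
/-- The linear part `x ↦ α x + γ A x` of the argument of the nonlinearity. -/
noncomputable def drive : (V → ℝ) →L[ℝ] (V → ℝ) :=
  LinearMap.toContinuousLinearMap (α • LinearMap.id + γ • Matrix.toLin' (G.adjMatrix ℝ))

theorem drive_apply (x : V → ℝ) : drive G α γ x = α • x + γ • G.adjMatrix ℝ *ᵥ x := by
  simp [drive, Matrix.toLin'_apply]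

theorem isEquilibrium_iff {x : V → ℝ} :
    IsEquilibrium G S d α γ u x ↔ ∀ i, d * x i = u * S (drive G α γ x i) := by
  refine forall_congr' fun i => ?_
  have h : ∑ k ∈ Finset.univ.erase i, G.adjMatrix ℝ i k * x k = (G.adjMatrix ℝ *ᵥ x) i := by
    rw [Matrix.mulVec, dotProduct, ← Finset.add_sum_erase _ _ (Finset.mem_univ i)]
    simp
  simp only [vectorField, h, drive_apply, Pi.add_apply, Pi.smul_apply, smul_eq_mul]
  constructor <;> intro h <;> linarith

theorem drive_comp_iso (ρ : G ≃g G) (x : V → ℝ) :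
    drive G α γ (x ∘ ρ) = drive G α γ x ∘ ρ := by
  rw [drive_apply, drive_apply, adjMatrix_mulVec_comp_iso]
  rfl

theorem IsEquilibrium.comp_iso {x : V → ℝ} (hx : IsEquilibrium G S d α γ u x) (ρ : G ≃g G) :
    IsEquilibrium G S d α γ u (x ∘ ρ) := by
  rw [isEquilibrium_iff] at hx ⊢
  intro i
  rw [drive_comp_iso]
  exact hx (ρ i)

theorem IsEquilibrium.neg {x : V → ℝ} (hx : IsEquilibrium G S d α γ u x)
    (hS : IsSaturation S) : IsEquilibrium G S d α γ u (-x) := by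
  rw [isEquilibrium_iff] at hx ⊢
  intro i
  rw [map_neg, Pi.neg_apply, Pi.neg_apply, hS.odd]
  linarith [hx i]

theorem mulVec_eq_of_critical {w : V → ℝ} {μ : ℝ} (hd : d ≠ 0) (hγ : γ ≠ 0)
    (h : d • w = (d / (α + γ * μ)) • drive G α γ w) :
    G.adjMatrix ℝ *ᵥ w = μ • w := by
  -- Division by zero puts the threshold at `0` here, and then `d • w = 0`.
  by_cases h0 : α + γ * μ = 0
  · rw [h0, div_zero, zero_smul] at h
    rw [(smul_eq_zero.1 h).resolve_left hd, Matrix.mulVec_zero, smul_zero]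
  · funext i
    have hi := congrFun h i
    rw [drive_apply] at hi
    simp only [Pi.smul_apply, Pi.add_apply, smul_eq_mul] at hi ⊢
    field_simp at hi
    exact mul_left_cancel₀ hγ (by linarith)

/-- Let `t` be the largest ratio `x j / y j`, attained at `m`. If `t > 1`, monotonicity and
sublinearity of `S` give `d * x m < t * (d * y m) = d * x m`. -/
theorem le_of_isEquilibrium_of_pos (hS : IsSaturation S) (hd : 0 < d) (hα : 0 < α) (hγ : 0 ≤ γ)
    (hu : 0 ≤ u) {x y : V → ℝ} (hx : IsEquilibrium G S d α γ u x)
    (hy : IsEquilibrium G S d α γ u y) (hx0 : ∀ i, 0 < x i) (hy0 : ∀ i, 0 < y i) (i : V) :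
    x i ≤ y i := by
  rw [isEquilibrium_iff] at hx hy
  have := Nonempty.intro i
  obtain ⟨m, hm⟩ := Finite.exists_max fun j => x j / y j
  set t := x m / y m with ht
  have hle : ∀ j, x j ≤ t * y j := fun j => (div_le_iff₀ (hy0 j)).1 (hm j)
  have hA : ∀ j k, 0 ≤ G.adjMatrix ℝ j k := fun j k => by
    rw [SimpleGraph.adjMatrix_apply]
    split_ifs <;> simp
  have hdrive_pos : ∀ z : V → ℝ, (∀ j, 0 < z j) → ∀ j, 0 < drive G α γ z j := fun z hz j => by
    rw [drive_apply]
    exact add_pos_of_pos_of_nonneg (mul_pos hα (hz j))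
      (mul_nonneg hγ (Finset.sum_nonneg fun k _ => mul_nonneg (hA j k) (hz k).le))
  suffices ht1 : t ≤ 1 from (hle i).trans (mul_le_of_le_one_left (hy0 i).le ht1)
  by_contra! ht1
  have hmono : drive G α γ x m ≤ t * drive G α γ y m := by
    have h : drive G α γ x m ≤ drive G α γ (t • y) m := by
      rw [drive_apply, drive_apply]
      refine add_le_add (mul_le_mul_of_nonneg_left (hle m) hα.le)
        (mul_le_mul_of_nonneg_left (Finset.sum_le_sum fun k _ => ?_) hγ)
      exact mul_le_mul_of_nonneg_left (hle k) (hA m k)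
    rwa [map_smul] at h
  have hu0 : 0 < u := by
    refine lt_of_le_of_ne hu ?_
    rintro rfl
    have := hx m
    rw [zero_mul] at this
    exact (mul_pos hd (hx0 m)).ne' this
  have hxm : x m = t * y m := (div_mul_cancel₀ _ (hy0 m).ne').symm
  have h1 : S (drive G α γ x m) < t * S (drive G α γ y m) :=
    (hS.monotoneOn (hdrive_pos x hx0 m).le
      ((hdrive_pos x hx0 m).le.trans hmono) hmono).trans_lt
      (hS.map_mul_lt ht1 (hdrive_pos y hy0 m))
  have h2 := mul_lt_mul_of_pos_left h1 hu0
  rw [← hx m, hxm] at h2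
  have h3 := hy m
  nlinarith

theorem eq_of_isEquilibrium_of_pos (hS : IsSaturation S) (hd : 0 < d) (hα : 0 < α) (hγ : 0 ≤ γ)
    (hu : 0 ≤ u) {x y : V → ℝ} (hx : IsEquilibrium G S d α γ u x)
    (hy : IsEquilibrium G S d α γ u y) (hx0 : ∀ i, 0 < x i) (hy0 : ∀ i, 0 < y i) : x = y :=
  funext fun i => le_antisymm (le_of_isEquilibrium_of_pos hS hd hα hγ hu hx hy hx0 hy0 i)
    (le_of_isEquilibrium_of_pos hS hd hα hγ hu hy hx hy0 hx0 i)

theorem eq_comp_iso_of_isAgreement (hS : IsSaturation S) (hd : 0 < d) (hα : 0 < α) (hγ : 0 ≤ γ)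
    (hu : 0 ≤ u) {x : V → ℝ} (hx : IsEquilibrium G S d α γ u x) (hxa : IsAgreement x)
    (ρ : G ≃g G) : x = x ∘ ρ := by
  obtain ⟨hne, hsign⟩ := hxa
  by_cases hpos : ∀ i, 0 < x i
  · exact eq_of_isEquilibrium_of_pos hS hd hα hγ hu hx (hx.comp_iso ρ) hpos fun i => hpos (ρ i)
  · push Not at hpos
    obtain ⟨j, hj⟩ := hpos
    have hneg : ∀ i, 0 < (-x) i := fun i => by
      have h := hsign i j
      rw [sign_neg (lt_of_le_of_ne hj (hne j)), sign_eq_neg_one_iff] at h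
      exact neg_pos.2 h
    exact neg_injective (eq_of_isEquilibrium_of_pos hS hd hα hγ hu (hx.neg hS)
      ((hx.comp_iso ρ).neg hS) hneg fun i => hneg (ρ i))

theorem eventually_eq_smul_comp_iso (hS : IsSaturation S) {u₀ : ℝ} (l : (V → ℝ) →L[ℝ] ℝ)
    (hker : ∀ w : V → ℝ, d • w = u₀ • drive G α γ w → l w = 0 → w = 0) (ρ : G ≃g G)
    {ε : ℝ} (hε : ε = 1 ∨ ε = -1) (hl : ∀ x : V → ℝ, l (x ∘ ρ) = ε * l x) :
    ∀ᶠ p : (V → ℝ) × ℝ in 𝓝 (0, u₀),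
      IsEquilibrium G S d α γ p.2 p.1 → p.1 = ε • (p.1 ∘ ρ) := by
  have hcont : Continuous fun p : (V → ℝ) × ℝ => (p, (ε • (p.1 ∘ ρ), p.2)) := by
    refine continuous_id.prodMk (Continuous.prodMk (Continuous.const_smul ?_ ε) continuous_snd)
    exact continuous_pi fun i => (continuous_apply (ρ i)).comp continuous_fst
  have htend := hcont.tendsto ((0 : V → ℝ), u₀)
  have hzero : ε • ((0 : V → ℝ) ∘ ρ) = 0 := smul_zero ε
  simp only [hzero] at htend
  filter_upwards [htend.eventually (eventually_eq_of_functional_eq hS.hasStrictDerivAt_zero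
    hS.map_zero (drive G α γ) l d u₀ hker)] with p hp hx
  have hy : IsEquilibrium G S d α γ p.2 (ε • (p.1 ∘ ρ)) := by
    rcases hε with rfl | rfl
    · rw [one_smul]
      exact hx.comp_iso ρ
    · rw [neg_smul, one_smul]
      exact (hx.comp_iso ρ).neg hS
  refine congrArg Prod.fst (hp (isEquilibrium_iff.1 hx) (isEquilibrium_iff.1 hy) ?_ rfl)
  rw [map_smul, hl, smul_eq_mul, ← mul_assoc]
  rcases hε with rfl | rfl <;> simp

theorem eventually_eq_of_sameOrbit (hG : G.Connected) (hS : IsSaturation S) (hd : d ≠ 0)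
    (hγ : γ ≠ 0) :
    ∀ᶠ p : (V → ℝ) × ℝ in 𝓝 (0, agreementThreshold G d α γ),
      IsEquilibrium G S d α γ p.2 p.1 → ∀ i k, SameOrbit G i k → p.1 i = p.1 k := by
  let l : (V → ℝ) →L[ℝ] ℝ := ∑ i, ContinuousLinearMap.proj i
  have hl : ∀ x, l x = ∑ i, x i := fun x => by simp [l]
  -- Finitely many automorphisms, so their neighbourhoods can be intersected.
  have hfin : Finite (G ≃g G) := DFunLike.finite _
  have h : ∀ ρ : G ≃g G, ∀ᶠ p : (V → ℝ) × ℝ in 𝓝 (0, agreementThreshold G d α γ),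
      IsEquilibrium G S d α γ p.2 p.1 → p.1 = (1 : ℝ) • (p.1 ∘ ρ) := fun ρ =>
    eventually_eq_smul_comp_iso hS l
      (fun w hw hlw => eq_zero_of_mulVec_eq_of_sum_eq_zero hG (mulVec_eq_of_critical hd hγ hw)
        ((hl w).symm.trans hlw))
      ρ (Or.inl rfl) fun x => by
        rw [hl, hl, one_mul]
        exact Equiv.sum_comp ρ.toEquiv x
  filter_upwards [eventually_all.2 h] with p hp hx i k hik
  obtain ⟨ρ, rfl⟩ := hik
  simpa using congrFun (hp ρ hx) i

theorem eventually_abs_eq_of_sameOrbit [Nonempty V] (hS : IsSaturation S) (hd : d ≠ 0)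
    (hγ : γ ≠ 0) (h1 : Module.finrank ℝ (genEigenspace G (lambdaMin G)) = 1) :
    ∀ᶠ p : (V → ℝ) × ℝ in 𝓝 (0, disagreementThreshold G d α γ),
      IsEquilibrium G S d α γ p.2 p.1 → ∀ i k, SameOrbit G i k → |p.1 i| = |p.1 k| := by
  obtain ⟨v, hv0, hv, hspan⟩ := exists_eigenvector_lambdaMin h1
  let l : (V → ℝ) →L[ℝ] ℝ := ∑ i, v i • ContinuousLinearMap.proj i
  have hl : ∀ x, l x = v ⬝ᵥ x := fun x => by simp [l, dotProduct]
  have hker : ∀ w : V → ℝ, d • w = disagreementThreshold G d α γ • drive G α γ w →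
      l w = 0 → w = 0 := fun w hw hlw => by
    obtain ⟨c, rfl⟩ := hspan w (mulVec_eq_of_critical hd hγ hw)
    rw [hl, dotProduct_smul, smul_eq_mul] at hlw
    rw [(mul_eq_zero.1 hlw).resolve_right fun h => hv0 (dotProduct_self_eq_zero.1 h), zero_smul]
  have hfin : Finite (G ≃g G) := DFunLike.finite _
  have h : ∀ ρ : G ≃g G, ∀ᶠ p : (V → ℝ) × ℝ in 𝓝 (0, disagreementThreshold G d α γ),
      IsEquilibrium G S d α γ p.2 p.1 → ∀ i, |p.1 i| = |p.1 (ρ i)| := fun ρ => by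
    obtain ⟨ε, hε, hvρ⟩ : ∃ ε : ℝ, (ε = 1 ∨ ε = -1) ∧ v ∘ ρ = ε • v := by
      rcases comp_iso_eq_or_eq_neg hv0 hv hspan ρ with h | h
      · exact ⟨1, Or.inl rfl, by rw [h, one_smul]⟩
      · exact ⟨-1, Or.inr rfl, by rw [h, neg_smul, one_smul]⟩
    have hlρ : ∀ x : V → ℝ, l (x ∘ ρ) = ε * l x := fun x => by
      have hinv : (v ∘ ρ) ⬝ᵥ (x ∘ ρ) = v ⬝ᵥ x := Equiv.sum_comp ρ.toEquiv fun i => v i * x i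
      rw [hl, hl, ← hinv, hvρ, smul_dotProduct, smul_eq_mul, ← mul_assoc]
      rcases hε with rfl | rfl <;> simp
    filter_upwards [eventually_eq_smul_comp_iso hS l hker ρ hε hlρ] with p hp hx i
    have hi := congrFun (hp hx) i
    rw [Pi.smul_apply, Function.comp_apply, smul_eq_mul] at hi
    rw [hi, abs_mul]
    rcases hε with rfl | rfl <;> simp
  filter_upwards [eventually_all.2 h] with p hp hx i k hik
  obtain ⟨ρ, rfl⟩ := hik
  exact hp ρ hx i

end Equilibria

end OpinionDynamics

theorem theorem6 {V : Type*} [Fintype V] [DecidableEq V]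
    (G : SimpleGraph V) [DecidableRel G.Adj] (hG : G.Connected)
    (S : ℝ → ℝ) (hS : OpinionDynamics.IsSaturation S)
    (d α γ : ℝ) (hd : 0 < d) (hα : 0 < α) :
    -- Part A: equilibria emerging at `u_a`, and all agreement equilibria for any `u ≥ 0`
    (0 < γ →
      (∀ᶠ p : (V → ℝ) × ℝ in 𝓝 (0, OpinionDynamics.agreementThreshold G d α γ),
        OpinionDynamics.IsEquilibrium G S d α γ p.2 p.1 →
          ∀ i k, OpinionDynamics.SameOrbit G i k → p.1 i = p.1 k) ∧
      (∀ u : ℝ, 0 ≤ u → ∀ x : V → ℝ, OpinionDynamics.IsEquilibrium G S d α γ u x →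
        OpinionDynamics.IsAgreement x →
          ∀ i k, OpinionDynamics.SameOrbit G i k → x i = x k)) ∧
    -- Part B: equilibria emerging at `u_d`
    (γ < 0 →
      Module.finrank ℝ (OpinionDynamics.genEigenspace G (OpinionDynamics.lambdaMin G)) = 1 →
      ∀ᶠ p : (V → ℝ) × ℝ in 𝓝 (0, OpinionDynamics.disagreementThreshold G d α γ),
        OpinionDynamics.IsEquilibrium G S d α γ p.2 p.1 →
          ∀ i k, OpinionDynamics.SameOrbit G i k → |p.1 i| = |p.1 k|) := by
  have := hG.nonempty
  refine ⟨fun hγ => ⟨OpinionDynamics.eventually_eq_of_sameOrbit hG hS hd.ne' hγ.ne', ?_⟩,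
    fun hγ h1 => OpinionDynamics.eventually_abs_eq_of_sameOrbit hS hd.ne' hγ.ne h1⟩
  rintro u hu x hx hxa i _ ⟨ρ, rfl⟩
  exact congrFun (OpinionDynamics.eq_comp_iso_of_isAgreement hS hd hα hγ.le hu hx hxa ρ) i
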